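/- Let $\mathbb{M}_{n_1,n_2}$ be the space of $n_1\times n_2$ matrices with real or complex entries, with the Frobenius norm $\|X\|$ and the real Frobenius inner product $\operatorname{Re}\operatorname{tr}(X^*Y)$. Let $\mathcal{H}$ be a finite-dimensional real inner product space (for instance $\mathbb{R}^m$, or $\mathbb{C}^m$ with the real part of its inner product), let $\mathcal{A}:\mathbb{M}_{n_1,n_2}\to\mathcal{H}$ be a (real-)linear map with adjoint $\mathcal{A}^*$, let $b\in\mathcal{H}$ and let $K\ge 1$ be an integer. Put $\iota_{R_K}(X)=0$ if $\operatorname{rank}(X)\le K$ and $\iota_{R_K}(X)=+\infty$ otherwise. For an extended-real-valued functional $f$ on $\mathbb{M}_{n_1,n_2}$ put $\mathcal{S}_2(f)(Y)=\sup_X\big(-f(X)-\|X-Y\|^2\big)$, and let $\mathcal{Q}_2(f)=\mathcal{S}_2(\mathcal{S}_2(f))$ be its quadratic envelope. Consider $$\mathcal{R}_{K,reg}(X)=\mathcal{Q}_2(\iota_{R_K})(X)+\|\mathcal{A}X-b\|^2 .$$ A point $X$ is called stationary for a functional $g$ if $$\liminf_{Y\to X,\;Y\ne X}\frac{g(Y)-g(X)}{\|Y-X\|}\ge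 0 .$$ Define $\delta_{2K}^-$ by $$1-\delta_{2K}^-=\inf\left\{\frac{\|\mathcal{A}X\|^2}{\|X\|^2}:\ X\neq 0,\ \operatorname{rank}(X)\le 2K\right\},$$ and let $\sigma_1(Z)\ge\sigma_2(Z)\ge\cdots$ be the singular values of a matrix $Z$, with $\sigma_j(Z)=0$ for $j>\min(n_1,n_2)$. **Theorem.** Let $X'$ be a stationary point of $\mathcal{R}_{K,reg}$ with $\operatorname{rank}(X')\le K$, and set $Z'=(I-\mathcal{A}^*\mathcal{A})X'+\mathcal{A}^*b$. If $$\sigma_{K+1}(Z')<(1-2\delta_{2K}^-)\,\sigma_K(Z'),$$ then $\mathcal{R}_{K,reg}$ has no other stationary point of rank at most $K$: every stationary point $X''$ of $\mathcal{R}_{K,reg}$ with $\operatorname{rank}(X'')\le K$ equals $X'$. -/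

import Mathlib

open Filter Topology

attribute [local instance] Matrix.frobeniusNormedAddCommGroup Matrix.frobeniusNormedSpace

/-- The space of `n₁ × n₂` matrices over `𝕜` (`ℝ` or `ℂ`), equipped with the Frobenius norm, is a
real inner product space for the real Frobenius inner product `Re tr (Xᴴ Y)`. -/
noncomputable instance frobeniusInnerProductSpace {𝕜 : Type*} [RCLike 𝕜] {n₁ n₂ : ℕ} :
    InnerProductSpace ℝ (Matrix (Fin n₁) (Fin n₂) 𝕜) where
  toNormedSpace := Matrix.frobeniusNormedSpace
  inner X Y := RCLike.re (X.conjTranspose * Y).trace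
  norm_sq_eq_re_inner X := by
    rw [Matrix.frobenius_norm_def, ← Real.sqrt_eq_rpow, Real.sq_sqrt (by positivity)]
    simp only [Matrix.trace, Matrix.diag_apply, Matrix.mul_apply, Matrix.conjTranspose_apply,
      RCLike.star_def, RCLike.conj_mul, map_sum, Real.rpow_two, RCLike.re_to_real]
    rw [Finset.sum_comm]
    refine Finset.sum_congr rfl fun j _ => Finset.sum_congr rfl fun i _ => ?_
    rw [← RCLike.ofReal_pow, RCLike.ofReal_re]
  conj_inner_symm X Y := by
    have h : (Y.conjTranspose * X).trace = star (X.conjTranspose * Y).trace := by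
      rw [← Matrix.trace_conjTranspose, Matrix.conjTranspose_mul, Matrix.conjTranspose_conjTranspose]
    simp [h]
  add_left X Y Z := by simp [Matrix.add_mul]
  smul_left X Y r := by
    simp [Matrix.conjTranspose_smul, RCLike.smul_re]

/-- The transform `S_γ(f)(Y) = sup_X (-f(X) - γ/2 ‖X - Y‖²)`. -/
noncomputable def sTransform {V : Type*} [NormedAddCommGroup V] (γ : ℝ) (f : V → EReal) :
    V → EReal :=
  fun Y => ⨆ X : V, (-f X - ((γ / 2 * ‖X - Y‖ ^ 2 : ℝ) : EReal))

/-- The quadratic envelope `Q_γ(f) = S_γ(S_γ(f))`. -/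
noncomputable def quadraticEnvelope {V : Type*} [NormedAddCommGroup V] (γ : ℝ) (f : V → EReal) :
    V → EReal :=
  sTransform γ (sTransform γ f)

/-- `X` is a stationary point of the extended-real-valued functional `g` if
`liminf_{Y → X, Y ≠ X} (g(Y) - g(X)) / ‖Y - X‖ ≥ 0`. -/
def IsStationaryPoint {V : Type*} [NormedAddCommGroup V] (g : V → EReal) (X : V) : Prop :=
  0 ≤ liminf (fun Y => (g Y - g X) / ((‖Y - X‖ : ℝ) : EReal)) (𝓝[≠] X)

/-- The indicator functional of the set of matrices of rank at most `K`: it is `0` on this set and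
`∞` elsewhere. -/
noncomputable def rankIndicator {𝕜 : Type*} [RCLike 𝕜] {n₁ n₂ : ℕ} (K : ℕ) :
    Matrix (Fin n₁) (Fin n₂) 𝕜 → EReal :=
  fun X => if X.rank ≤ K then 0 else ⊤

/-- The regularized functional `Q_2(ι_{rank ≤ K})(X) + ‖A X - b‖²`. -/
noncomputable def regularizedFunctional {𝕜 : Type*} [RCLike 𝕜] {n₁ n₂ : ℕ}
    {F : Type*} [NormedAddCommGroup F] [InnerProductSpace ℝ F]
    (A : Matrix (Fin n₁) (Fin n₂) 𝕜 →ₗ[ℝ] F) (b : F) (K : ℕ) :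
    Matrix (Fin n₁) (Fin n₂) 𝕜 → EReal :=
  fun X => quadraticEnvelope 2 (rankIndicator K) X + ((‖A X - b‖ ^ 2 : ℝ) : EReal)

/-- The lower restricted isometry constant `δ_K⁻` of `A`, given by
`1 - δ_K⁻ = inf {‖A X‖² / ‖X‖² : X ≠ 0, rank X ≤ K}`. -/
noncomputable def lrip {𝕜 : Type*} [RCLike 𝕜] {n₁ n₂ : ℕ}
    {F : Type*} [NormedAddCommGroup F] [InnerProductSpace ℝ F]
    (A : Matrix (Fin n₁) (Fin n₂) 𝕜 →ₗ[ℝ] F) (K : ℕ) : ℝ :=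
  1 - sInf {t : ℝ | ∃ X : Matrix (Fin n₁) (Fin n₂) 𝕜,
    X ≠ 0 ∧ X.rank ≤ K ∧ t = ‖A X‖ ^ 2 / ‖X‖ ^ 2}

/-- The `j`-th largest singular value of a matrix, for `j = 1, 2, …` (so the largest is `j = 1`);
it is `0` for `j > min n₁ n₂`. Mathlib's sequence of singular values starts at index `0`. -/
noncomputable def singularValue {𝕜 : Type*} [RCLike 𝕜] {n₁ n₂ : ℕ} (j : ℕ)
    (X : Matrix (Fin n₁) (Fin n₂) 𝕜) : ℝ :=
  (Matrix.toEuclideanLin X).singularValues (j - 1)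

/-- The point `Z = (I - A* A) X + A* b`, with `A*` the adjoint of `A` for the Frobenius inner
product. -/
noncomputable def dualPoint {𝕜 : Type*} [RCLike 𝕜] {n₁ n₂ : ℕ}
    {F : Type*} [NormedAddCommGroup F] [InnerProductSpace ℝ F] [FiniteDimensional ℝ F]
    (A : Matrix (Fin n₁) (Fin n₂) 𝕜 →ₗ[ℝ] F) (b : F) (X : Matrix (Fin n₁) (Fin n₂) 𝕜) :
    Matrix (Fin n₁) (Fin n₂) 𝕜 :=
  (X - LinearMap.adjoint A (A X)) + LinearMap.adjoint A b

/-!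
Along the segment from `X` to `Y`, both of rank at most `K`, the quadratic envelope is at most
`t (1 - t) ‖Y - X‖²`. Stationarity at `X` in the direction `Y - X` therefore says that
`2 ⟪Z - X, Y - X⟫ ≤ ‖Y - X‖²` for `Z = (I - A*A)X + A*b`: the vector `Z - X` is a proximal normal
to `R_K` at `X`, with constant `1`, and `X` is a best approximation of `Z` in `R_K`.

When `σ_{K+1}(Z) < σ_K(Z)`, this forces `X` to be the truncated singular value decomposition of
`Z`. The truncation remains a best approximation after the tail singular values of `Z` are
multiplied by `σ_K(Z) / σ_{K+1}(Z)`, so the constant of the proximal normal improves to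
`σ_{K+1}(Z) / σ_K(Z)`. Using the improved constant at `X'` and the constant `1` at `X''`, and adding
the two inequalities, one obtains
`2 ‖A(X'' - X')‖² ≤ (1 + σ_{K+1}(Z') / σ_K(Z')) ‖X'' - X'‖² < 2 (1 - δ) ‖X'' - X'‖²` with
`δ = δ_{2K}⁻` unless `X'' = X'`, against the restricted isometry bound on `X'' - X'`.
-/

section QuadraticEnvelope

variable {V : Type*} [NormedAddCommGroup V] {γ : ℝ} {f : V → EReal}

lemma sTransform_nonpos (hγ : 0 ≤ γ) (hf : ∀ x, 0 ≤ f x) (y : V) : sTransform γ f y ≤ 0 := by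
  refine iSup_le fun x => ?_
  have hdist : (0 : EReal) ≤ ((γ / 2 * ‖x - y‖ ^ 2 : ℝ) : EReal) :=
    EReal.coe_nonneg.2 (by positivity)
  simpa using EReal.sub_le_sub (EReal.neg_le_zero.2 (hf x)) hdist

lemma quadraticEnvelope_nonneg (hγ : 0 ≤ γ) (hf : ∀ x, 0 ≤ f x) (x : V) :
    0 ≤ quadraticEnvelope γ f x :=
  le_iSup_of_le x (by simpa using sTransform_nonpos hγ hf x)

lemma neg_sTransform_le_of_eq_zero {x : V} (hx : f x = 0) (v : V) :
    -sTransform γ f v ≤ ((γ / 2 * ‖x - v‖ ^ 2 : ℝ) : EReal) :=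
  EReal.neg_le.1 (le_iSup_of_le x (by simp [hx]))

variable [InnerProductSpace ℝ V]

lemma norm_sq_convex_combination (x y : V) (t : ℝ) :
    ‖x + t • (y - x)‖ ^ 2 = (1 - t) * ‖x‖ ^ 2 + t * ‖y‖ ^ 2 - t * (1 - t) * ‖y - x‖ ^ 2 := by
  rw [norm_add_sq_real, norm_smul, mul_pow, norm_sub_sq_real, inner_smul_right, inner_sub_right,
    real_inner_self_eq_norm_sq, real_inner_comm y x, Real.norm_eq_abs, sq_abs]
  ring

lemma quadraticEnvelope_segment_le {x y : V} (hx : f x = 0) (hy : f y = 0) {t : ℝ} (ht0 : 0 ≤ t)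
    (ht1 : t ≤ 1) :
    quadraticEnvelope γ f (x + t • (y - x)) ≤
      ((γ / 2 * (t * (1 - t) * ‖y - x‖ ^ 2) : ℝ) : EReal) := by
  refine iSup_le fun v => ?_
  have hS : -sTransform γ f v ≤
      ((γ / 2 * ((1 - t) * ‖x - v‖ ^ 2 + t * ‖y - v‖ ^ 2) : ℝ) : EReal) := by
    refine (le_min (neg_sTransform_le_of_eq_zero hx v)
      (neg_sTransform_le_of_eq_zero hy v)).trans ?_
    rw [← EReal.coe_strictMono.monotone.map_min, EReal.coe_le_coe_iff]
    refine (Convex.min_le_combo _ _ (sub_nonneg.2 ht1) ht0 (sub_add_cancel 1 t)).trans_eq ?_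
    simp only [smul_eq_mul]
    ring
  have hnorm : ‖v - (x + t • (y - x))‖ ^ 2 =
      (1 - t) * ‖x - v‖ ^ 2 + t * ‖y - v‖ ^ 2 - t * (1 - t) * ‖y - x‖ ^ 2 := by
    have hsub : x + t • (y - x) - v = x - v + t • (y - v - (x - v)) := by
      rw [sub_sub_sub_cancel_right]
      abel
    rw [norm_sub_rev, hsub, norm_sq_convex_combination, sub_sub_sub_cancel_right]
  refine (EReal.sub_le_sub hS le_rfl).trans ?_
  rw [← EReal.coe_sub, EReal.coe_le_coe_iff, hnorm]
  exact le_of_eq (by ring)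

end QuadraticEnvelope

section Stationarity

variable {V : Type*} [NormedAddCommGroup V]

lemma tendsto_add_smul_nhdsNE [NormedSpace ℝ V] (x : V) {d : V} (hd : d ≠ 0) :
    Tendsto (fun t : ℝ => x + t • d) (𝓝[>] 0) (𝓝[≠] x) := by
  refine tendsto_nhdsWithin_iff.2 ⟨?_, ?_⟩
  · have hcont : Continuous fun t : ℝ => x + t • d := by fun_prop
    exact (hcont.tendsto' 0 x (by simp)).mono_left nhdsWithin_le_nhds
  · filter_upwards [self_mem_nhdsWithin] with t ht
    simpa [hd] using ne_of_gt ht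

lemma IsStationaryPoint.nonneg_of_tendsto [NormedSpace ℝ V] {g : V → EReal} {x d : V}
    {q : ℝ → ℝ} {a : ℝ} (hg : IsStationaryPoint g x) (hd : d ≠ 0)
    (hle : ∀ᶠ t in 𝓝[>] 0, g (x + t • d) - g x ≤ ((t * q t : ℝ) : EReal))
    (hq : Tendsto q (𝓝[>] 0) (𝓝 a)) : 0 ≤ a := by
  have hd0 : 0 < ‖d‖ := norm_pos_iff.2 hd
  have hquot : ∀ᶠ t in 𝓝[>] 0,
      (g (x + t • d) - g x) / ((‖x + t • d - x‖ : ℝ) : EReal) ≤ ((q t / ‖d‖ : ℝ) : EReal) := by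
    filter_upwards [hle, self_mem_nhdsWithin] with t hle (ht : 0 < t)
    have hnorm : ‖x + t • d - x‖ = t * ‖d‖ := by
      rw [add_sub_cancel_left, norm_smul, Real.norm_of_nonneg ht.le]
    refine (EReal.div_le_div_right_of_nonneg (EReal.coe_nonneg.2 (norm_nonneg _)) hle).trans_eq ?_
    rw [hnorm, ← EReal.coe_div, mul_div_mul_left _ _ ht.ne']
  have hlim : Tendsto (fun t => ((q t / ‖d‖ : ℝ) : EReal)) (𝓝[>] 0) (𝓝 ((a / ‖d‖ : ℝ) : EReal)) :=
    (continuous_coe_real_ereal.tendsto _).comp (hq.div_const _)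
  have hslope : (0 : EReal) ≤ ((a / ‖d‖ : ℝ) : EReal) :=
    calc (0 : EReal)
      _ ≤ liminf (fun y => (g y - g x) / ((‖y - x‖ : ℝ) : EReal)) (𝓝[≠] x) := hg
      _ ≤ liminf (fun y => (g y - g x) / ((‖y - x‖ : ℝ) : EReal))
            (map (fun t : ℝ => x + t • d) (𝓝[>] 0)) :=
          liminf_le_liminf_of_le (tendsto_add_smul_nhdsNE x hd)
      _ ≤ liminf (fun t => ((q t / ‖d‖ : ℝ) : EReal)) (𝓝[>] 0) := liminf_le_liminf hquot
      _ = ((a / ‖d‖ : ℝ) : EReal) := hlim.liminf_eq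
  simpa [hd0.ne'] using mul_nonneg (EReal.coe_nonneg.1 hslope) hd0.le

variable [InnerProductSpace ℝ V]

lemma IsStationaryPoint.nonneg_of_hasLineDerivAt {γ : ℝ} (hγ : 0 ≤ γ) {f : V → EReal}
    (hf : ∀ v, 0 ≤ f v) {φ : V → ℝ} {φ' : ℝ} {x y : V}
    (hst : IsStationaryPoint (fun v => quadraticEnvelope γ f v + (φ v : EReal)) x)
    (hx : f x = 0) (hy : f y = 0) (hφ : HasLineDerivAt ℝ φ φ' x (y - x)) :
    0 ≤ γ / 2 * ‖y - x‖ ^ 2 + φ' := by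
  rcases eq_or_ne y x with rfl | hne
  · rw [sub_self] at hφ
    simp [hφ.unique hasLineDerivAt_zero]
  refine hst.nonneg_of_tendsto (d := y - x)
    (q := fun t => γ / 2 * ((1 - t) * ‖y - x‖ ^ 2) + t⁻¹ * (φ (x + t • (y - x)) - φ x))
    (sub_ne_zero.2 hne) ?_ ?_
  · filter_upwards [self_mem_nhdsWithin, nhdsWithin_le_nhds (Iic_mem_nhds one_pos)]
      with t (ht0 : 0 < t) (ht1 : t ≤ 1)
    have hupper := quadraticEnvelope_segment_le (γ := γ) hx hy ht0.le ht1
    have hlower : (φ x : EReal) ≤ quadraticEnvelope γ f x + (φ x : EReal) :=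
      le_add_of_nonneg_left (quadraticEnvelope_nonneg hγ hf x)
    refine (EReal.sub_le_sub (add_le_add hupper le_rfl) hlower).trans_eq ?_
    rw [← EReal.coe_add, ← EReal.coe_sub, EReal.coe_eq_coe_iff]
    field_simp
    ring
  · have hquad : Tendsto (fun t : ℝ => γ / 2 * ((1 - t) * ‖y - x‖ ^ 2)) (𝓝[>] 0)
        (𝓝 (γ / 2 * ‖y - x‖ ^ 2)) :=
      (Continuous.tendsto' (by fun_prop) 0 _ (by simp)).mono_left nhdsWithin_le_nhds
    exact hquad.add hφ.tendsto_slope_zero_right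

lemma hasLineDerivAt_norm_sub_sq {F : Type*} [NormedAddCommGroup F] [InnerProductSpace ℝ F]
    (A : V →ₗ[ℝ] F) (b : F) (x d : V) :
    HasLineDerivAt ℝ (fun v => ‖A v - b‖ ^ 2) (2 * inner ℝ (A x - b) (A d)) x d := by
  have hline : HasDerivAt (fun t : ℝ => A (x + t • d) - b) (A d) 0 := by
    simpa using (((hasDerivAt_id (0 : ℝ)).smul_const (A d)).const_add (A x)).sub_const b
  simpa [HasLineDerivAt] using hline.norm_sq

end Stationarity

section ProximalNormal

variable {V : Type*} [NormedAddCommGroup V] [InnerProductSpace ℝ V]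

/-- `e` is a proximal normal to the set `s` at its point `x`, with constant `r`. For `0 < r` this
says that `x` is a point of `s` nearest to `x + r⁻¹ • e`; in this form the constant may vanish, and
the defining inequalities at two points can be added. -/
structure IsProximalNormal (s : Set V) (r : ℝ) (x e : V) : Prop where
  mem : x ∈ s
  two_mul_inner_le : ∀ y ∈ s, 2 * inner ℝ e (y - x) ≤ r * ‖y - x‖ ^ 2

namespace IsProximalNormal

variable {s : Set V} {r r' c : ℝ} {x x' e e' : V}

lemma of_norm_sq_le (hx : x ∈ s) (h : ∀ y ∈ s, ‖e‖ ^ 2 ≤ ‖y - x - e‖ ^ 2) :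
    IsProximalNormal s 1 x e := by
  refine ⟨hx, fun y hy => ?_⟩
  have hy := h y hy
  rw [norm_sub_sq_real, real_inner_comm] at hy
  linarith

lemma of_smul (hc : 0 < c) (h : IsProximalNormal s r x (c • e)) :
    IsProximalNormal s (r / c) x e := by
  refine ⟨h.mem, fun y hy => ?_⟩
  have hy := h.two_mul_inner_le y hy
  rw [real_inner_smul_left] at hy
  rw [div_mul_eq_mul_div, le_div_iff₀ hc]
  linarith

lemma two_mul_inner_sub_le (h : IsProximalNormal s r x e) (h' : IsProximalNormal s r' x' e') :
    2 * inner ℝ (e - e') (x' - x) ≤ (r + r') * ‖x' - x‖ ^ 2 := by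
  have hxx' := h.two_mul_inner_le x' h'.mem
  have hx'x := h'.two_mul_inner_le x h.mem
  rw [← neg_sub x' x, inner_neg_right, norm_neg] at hx'x
  rw [inner_sub_left]
  linarith

lemma eq_of_add_eq_add (h : IsProximalNormal s r x e) (h' : IsProximalNormal s r' x' e')
    (hr : r + r' < 2) (hadd : x + e = x' + e') : x = x' := by
  have hle := h.two_mul_inner_sub_le h'
  have hsub : e - e' = x' - x := sub_eq_sub_iff_add_eq_add.2 ((add_comm e x).trans hadd)
  rw [hsub, real_inner_self_eq_norm_sq] at hle
  have hnorm : ‖x' - x‖ ^ 2 = 0 := by nlinarith [sq_nonneg ‖x' - x‖]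
  exact (sub_eq_zero.1 (norm_eq_zero.1 (pow_eq_zero_iff two_ne_zero |>.1 hnorm))).symm

end IsProximalNormal

end ProximalNormal

section LowRankApproximation

open Module

lemma sum_compl_le_sum_mul {ι : Type*} [Fintype ι] [DecidableEq ι] {s : Finset ι} {a ω : ι → ℝ}
    {c : ℝ} (hc : 0 ≤ c) (hlarge : ∀ i ∈ s, c ≤ a i) (hsmall : ∀ i ∉ s, a i ≤ c)
    (hω₀ : ∀ i, 0 ≤ ω i) (hω₁ : ∀ i, ω i ≤ 1) (hsum : (sᶜ.card : ℝ) ≤ ∑ i, ω i) :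
    ∑ i ∈ sᶜ, a i ≤ ∑ i, a i * ω i := by
  have hmissing : ∑ i ∈ sᶜ, (1 - ω i) ≤ ∑ i ∈ s, ω i := by
    rw [← Finset.sum_add_sum_compl s] at hsum
    rw [Finset.sum_sub_distrib, Finset.sum_const, nsmul_one]
    linarith
  calc ∑ i ∈ sᶜ, a i
    _ = ∑ i ∈ sᶜ, a i * (1 - ω i) + ∑ i ∈ sᶜ, a i * ω i := by
        rw [← Finset.sum_add_distrib]
        exact Finset.sum_congr rfl fun i _ => by ring
    _ ≤ ∑ i ∈ sᶜ, c * (1 - ω i) + ∑ i ∈ sᶜ, a i * ω i := by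
        gcongr with i hi
        · exact sub_nonneg.2 (hω₁ i)
        · exact hsmall i (Finset.mem_compl.1 hi)
    _ ≤ ∑ i ∈ s, c * ω i + ∑ i ∈ sᶜ, a i * ω i := by
        rw [← Finset.mul_sum, ← Finset.mul_sum]
        gcongr
    _ ≤ ∑ i ∈ s, a i * ω i + ∑ i ∈ sᶜ, a i * ω i := by
        gcongr with i hi
        · exact hω₀ i
        · exact hlarge i hi
    _ = ∑ i, a i * ω i := Finset.sum_add_sum_compl s _

variable {𝕜 E G ι : Type*} [RCLike 𝕜] [NormedAddCommGroup E] [InnerProductSpace 𝕜 E]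
  [NormedAddCommGroup G] [InnerProductSpace 𝕜 G] [Fintype ι]

lemma norm_sq_sum_of_pairwise_inner_eq_zero {u : ι → G}
    (hu : Pairwise fun i j => inner 𝕜 (u i) (u j) = 0) : ‖∑ i, u i‖ ^ 2 = ∑ i, ‖u i‖ ^ 2 := by
  classical
  rw [← RCLike.ofReal_inj (K := 𝕜), RCLike.ofReal_pow, ← inner_self_eq_norm_sq_to_K (𝕜 := 𝕜),
    sum_inner, RCLike.ofReal_sum]
  refine Finset.sum_congr rfl fun i _ => ?_
  rw [inner_sum, Finset.sum_eq_single i (fun j _ hj => hu hj.symm) (by simp),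
    inner_self_eq_norm_sq_to_K, RCLike.ofReal_pow]

lemma norm_sq_apply_of_pairwise_inner_eq_zero (v : OrthonormalBasis ι 𝕜 E) {T : E →ₗ[𝕜] G}
    (hT : Pairwise fun i j => inner 𝕜 (T (v i)) (T (v j)) = 0) (x : E) :
    ‖T x‖ ^ 2 = ∑ i, ‖T (v i)‖ ^ 2 * ‖inner 𝕜 (v i) x‖ ^ 2 := by
  have hx : T x = ∑ i, inner 𝕜 (v i) x • T (v i) := by
    conv_lhs => rw [← v.sum_repr' x]
    simp only [map_sum, map_smul]
  rw [hx, norm_sq_sum_of_pairwise_inner_eq_zero (𝕜 := 𝕜) fun i j hij => by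
    simp only [inner_smul_left, inner_smul_right, hT hij, mul_zero]]
  exact Finset.sum_congr rfl fun i _ => by rw [norm_smul, mul_pow, mul_comm]

lemma sum_norm_sq_apply_orthonormal_le [FiniteDimensional 𝕜 E] [FiniteDimensional 𝕜 G]
    {κ : Type*} [Fintype κ] {w : κ → E} (hw : Orthonormal 𝕜 w) (v : OrthonormalBasis ι 𝕜 E)
    (S : E →ₗ[𝕜] G) :
    ∑ k, ‖S (w k)‖ ^ 2 ≤ ∑ i, ‖S (v i)‖ ^ 2 := by
  let e := stdOrthonormalBasis 𝕜 G
  have hS (x : E) : ‖S x‖ ^ 2 = ∑ j, ‖inner 𝕜 x (LinearMap.adjoint S (e j))‖ ^ 2 := by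
    simp_rw [← e.sum_sq_norm_inner_left, LinearMap.adjoint_inner_right]
  simp_rw [hS]
  rw [Finset.sum_comm, Finset.sum_comm (s := (Finset.univ : Finset ι))]
  refine Finset.sum_le_sum fun j _ => ?_
  rw [v.sum_sq_norm_inner_right]
  exact hw.sum_inner_products_le _

variable [DecidableEq ι]

/-- The linear map that agrees with `T` on the basis vectors `v i` with `i ∈ s` and vanishes on the
other ones: a truncated singular value decomposition when `v` consists of right singular vectors
of `T`. -/
noncomputable def truncation (v : OrthonormalBasis ι 𝕜 E) (s : Finset ι) (T : E →ₗ[𝕜] G) :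
    E →ₗ[𝕜] G :=
  v.toBasis.constr 𝕜 fun i => if i ∈ s then T (v i) else 0

lemma truncation_apply_basis (v : OrthonormalBasis ι 𝕜 E) (s : Finset ι) (T : E →ₗ[𝕜] G) (i : ι) :
    truncation v s T (v i) = if i ∈ s then T (v i) else 0 := by
  rw [truncation, ← v.coe_toBasis, Basis.constr_basis]

lemma finrank_range_truncation_le (v : OrthonormalBasis ι 𝕜 E) (s : Finset ι) (T : E →ₗ[𝕜] G) :
    finrank 𝕜 (truncation v s T).range ≤ s.card := by
  classical
  have hle : (truncation v s T).range ≤ Submodule.span 𝕜 (s.image fun i => T (v i) : Finset G) := by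
    rw [truncation, Basis.constr_range, Submodule.span_le]
    rintro _ ⟨i, rfl⟩
    dsimp only
    split_ifs with hi
    · exact Submodule.subset_span (Finset.mem_image_of_mem _ hi)
    · exact Submodule.zero_mem _
  exact (Submodule.finrank_mono hle).trans
    ((finrank_span_finset_le_card _).trans Finset.card_image_le)

variable [FiniteDimensional 𝕜 E] [FiniteDimensional 𝕜 G]

/-- The lower bound in the Eckart–Young theorem, for the Hilbert–Schmidt norm. -/
lemma sum_compl_norm_sq_le_of_finrank_range_le (v : OrthonormalBasis ι 𝕜 E) {s : Finset ι}
    {T Y : E →ₗ[𝕜] G} (hT : Pairwise fun i j => inner 𝕜 (T (v i)) (T (v j)) = 0) {σ : ℝ}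
    (hσ : 0 ≤ σ) (hlarge : ∀ i ∈ s, σ ≤ ‖T (v i)‖) (hsmall : ∀ i ∉ s, ‖T (v i)‖ ≤ σ)
    (hY : finrank 𝕜 Y.range ≤ s.card) :
    ∑ i ∈ sᶜ, ‖T (v i)‖ ^ 2 ≤ ∑ i, ‖Y (v i) - T (v i)‖ ^ 2 := by
  let b := stdOrthonormalBasis 𝕜 Y.ker
  let w k : E := b k
  have hw : Orthonormal 𝕜 w := b.orthonormal.comp_linearIsometry Y.ker.subtypeₗᵢ
  -- `ω i` is the squared norm of the projection of `v i` onto `Y.ker`, where `Y - T` equals `-T`.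
  let ω (i : ι) : ℝ := ∑ k, ‖inner 𝕜 (v i) (w k)‖ ^ 2
  have hω₁ (i : ι) : ω i ≤ 1 := by
    simpa only [norm_inner_symm (w _), v.norm_eq_one, one_pow] using
      hw.sum_inner_products_le (v i) (s := Finset.univ)
  have hωsum : ∑ i, ω i = finrank 𝕜 Y.ker := by
    rw [Finset.sum_comm]
    simp only [v.sum_sq_norm_inner_right, hw.1, one_pow, Finset.sum_const, Finset.card_univ,
      Fintype.card_fin, nsmul_one]
  have hcard : sᶜ.card ≤ finrank 𝕜 Y.ker := by
    have hdim := finrank_eq_card_basis v.toBasis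
    have hker := Y.finrank_range_add_finrank_ker
    rw [Finset.card_compl]
    lia
  have hker (k) : ‖(Y - T) (w k)‖ ^ 2 = ∑ i, ‖T (v i)‖ ^ 2 * ‖inner 𝕜 (v i) (w k)‖ ^ 2 := by
    rw [← norm_sq_apply_of_pairwise_inner_eq_zero v hT, LinearMap.sub_apply,
      LinearMap.mem_ker.1 (b k).2, zero_sub, norm_neg]
  calc ∑ i ∈ sᶜ, ‖T (v i)‖ ^ 2
    _ ≤ ∑ i, ‖T (v i)‖ ^ 2 * ω i :=
        sum_compl_le_sum_mul (sq_nonneg σ) (fun i hi => by gcongr; exact hlarge i hi)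
          (fun i hi => by gcongr; exact hsmall i hi) (fun i => by positivity) hω₁
          (by rw [hωsum]; exact_mod_cast hcard)
    _ = ∑ k, ‖(Y - T) (w k)‖ ^ 2 := by
        simp only [ω, hker, Finset.mul_sum]
        rw [Finset.sum_comm]
    _ ≤ ∑ i, ‖Y (v i) - T (v i)‖ ^ 2 := sum_norm_sq_apply_orthonormal_le hw v (Y - T)

lemma sum_norm_sq_smul_sub_truncation_le (v : OrthonormalBasis ι 𝕜 E) {s : Finset ι}
    {T Y : E →ₗ[𝕜] G} (hT : Pairwise fun i j => inner 𝕜 (T (v i)) (T (v j)) = 0) {σ c : ℝ}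
    (hσ : 0 ≤ σ) (hc : 0 ≤ c) (hlarge : ∀ i ∈ s, σ ≤ ‖T (v i)‖)
    (hsmall : ∀ i ∉ s, c * ‖T (v i)‖ ≤ σ) (hY : finrank 𝕜 Y.range ≤ s.card) :
    ∑ i, ‖((c : 𝕜) • (T - truncation v s T)) (v i)‖ ^ 2 ≤
      ∑ i, ‖(Y - truncation v s T - (c : 𝕜) • (T - truncation v s T)) (v i)‖ ^ 2 := by
  set X := truncation v s T
  -- `U` is `T` with its tail singular values dilated by `c`; none of them exceeds `σ`, so
  -- `X` is a truncation of `U` as well and remains a best approximation.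
  set U := X + (c : 𝕜) • (T - X)
  have hX_mem {i} (hi : i ∈ s) : X (v i) = T (v i) := by
    simp only [X, truncation_apply_basis, if_pos hi]
  have hX_notMem {i} (hi : i ∉ s) : X (v i) = 0 := by
    simp only [X, truncation_apply_basis, if_neg hi]
  have hU_mem {i} (hi : i ∈ s) : U (v i) = T (v i) := by simp [U, hX_mem hi]
  have hU_notMem {i} (hi : i ∉ s) : U (v i) = (c : 𝕜) • T (v i) := by simp [U, hX_notMem hi]
  have hU : Pairwise fun i j => inner 𝕜 (U (v i)) (U (v j)) = 0 := fun i j hij => by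
    by_cases hi : i ∈ s <;> by_cases hj : j ∈ s <;>
      simp [hU_mem, hU_notMem, hi, hj, inner_smul_left, inner_smul_right, hT hij]
  calc ∑ i, ‖((c : 𝕜) • (T - X)) (v i)‖ ^ 2
    _ = ∑ i ∈ sᶜ, ‖U (v i)‖ ^ 2 := by
        rw [← Finset.sum_add_sum_compl s, Finset.sum_eq_zero, zero_add]
        · exact Finset.sum_congr rfl fun i hi => by
            simp [hU_notMem, hX_notMem, Finset.mem_compl.1 hi]
        · exact fun i hi => by simp [hX_mem hi]
    _ ≤ ∑ i, ‖Y (v i) - U (v i)‖ ^ 2 :=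
        sum_compl_norm_sq_le_of_finrank_range_le v hU hσ
          (fun i hi => by rw [hU_mem hi]; exact hlarge i hi)
          (fun i hi => by
            rw [hU_notMem hi, norm_smul, RCLike.norm_of_nonneg hc]; exact hsmall i hi) hY
    _ = ∑ i, ‖(Y - X - (c : 𝕜) • (T - X)) (v i)‖ ^ 2 := by
        simp only [U, sub_sub, LinearMap.sub_apply, LinearMap.add_apply]

lemma exists_orthonormalBasis_singularValues {n : ℕ} (hn : finrank 𝕜 E = n) (T : E →ₗ[𝕜] G) :
    ∃ v : OrthonormalBasis (Fin n) 𝕜 E, (Pairwise fun i j => inner 𝕜 (T (v i)) (T (v j)) = 0) ∧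
      ∀ i : Fin n, ‖T (v i)‖ = T.singularValues i := by
  let v := T.isSymmetric_adjoint_comp_self.eigenvectorBasis hn
  have hinner (i j : Fin n) :
      inner 𝕜 (T (v i)) (T (v j)) = (T.singularValues j ^ 2 : ℝ) * inner 𝕜 (v i) (v j) := by
    rw [← LinearMap.adjoint_inner_right, ← LinearMap.comp_apply,
      T.isSymmetric_adjoint_comp_self.apply_eigenvectorBasis hn j, inner_smul_right,
      T.sq_singularValues_fin hn]
  refine ⟨v, fun i j hij => by simp only [hinner, v.orthonormal.2 hij, mul_zero], fun i => ?_⟩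
  rw [← sq_eq_sq₀ (norm_nonneg _) (T.singularValues_nonneg _), ← inner_self_eq_norm_sq (𝕜 := 𝕜),
    hinner, inner_self_eq_norm_sq_to_K, v.norm_eq_one]
  simp

end LowRankApproximation

section Matrix

open Module Matrix

lemma rank_sub_le {R m n : Type*} [Field R] [Finite m] [Fintype n] (X Y : Matrix m n R) :
    (X - Y).rank ≤ X.rank + Y.rank := by
  have hle : (X - Y).mulVecLin.range ≤ X.mulVecLin.range ⊔ Y.mulVecLin.range := by
    rintro _ ⟨u, rfl⟩
    rw [mulVecLin_apply, sub_mulVec]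
    exact Submodule.sub_mem _ (Submodule.mem_sup_left ⟨u, rfl⟩) (Submodule.mem_sup_right ⟨u, rfl⟩)
  exact (Submodule.finrank_mono hle).trans (Submodule.finrank_add_le_finrank_add_finrank _ _)

variable {𝕜 : Type*} [RCLike 𝕜]

lemma rank_eq_finrank_range_toEuclideanLin {m n : Type*} [Finite m] [Fintype n] [DecidableEq n]
    (X : Matrix m n 𝕜) : X.rank = finrank 𝕜 (toEuclideanLin X).range := by
  rw [toEuclideanLin, toLpLin_eq_toLin]
  exact X.rank_eq_finrank_range_toLin _ _

variable {n₁ n₂ K : ℕ}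

lemma frobenius_norm_sq_eq_sum {ι : Type*} [Fintype ι]
    (v : OrthonormalBasis ι 𝕜 (EuclideanSpace 𝕜 (Fin n₂))) (X : Matrix (Fin n₁) (Fin n₂) 𝕜) :
    ‖X‖ ^ 2 = ∑ i, ‖toEuclideanLin X (v i)‖ ^ 2 := by
  have hgram : toEuclideanLin (Xᴴ * X) =
      LinearMap.adjoint (toEuclideanLin X) ∘ₗ toEuclideanLin X := by
    rw [← toEuclideanLin_conjTranspose_eq_adjoint]
    exact toLpLin_mul_same 2 _ _
  have htrace : LinearMap.trace 𝕜 _ (toEuclideanLin (Xᴴ * X)) = (Xᴴ * X).trace := by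
    rw [toEuclideanLin, toLpLin_eq_toLin, trace_toLin_eq]
  calc ‖X‖ ^ 2
    _ = RCLike.re (Xᴴ * X).trace := (real_inner_self_eq_norm_sq X).symm
    _ = ∑ i, ‖toEuclideanLin X (v i)‖ ^ 2 := by
        rw [← htrace, hgram, LinearMap.trace_eq_sum_inner _ v, map_sum]
        exact Finset.sum_congr rfl fun i _ => by
          rw [LinearMap.comp_apply, LinearMap.adjoint_inner_right, inner_self_eq_norm_sq]

/-- The set `R_K` of matrices of rank at most `K`, whose indicator functional is
`rankIndicator K`. -/
def boundedRank (𝕜 : Type*) [RCLike 𝕜] (n₁ n₂ K : ℕ) : Set (Matrix (Fin n₁) (Fin n₂) 𝕜) :=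
  {X | X.rank ≤ K}

lemma boundedRank_min_width : boundedRank 𝕜 n₁ n₂ (min K n₂) = boundedRank 𝕜 n₁ n₂ K :=
  Set.ext fun X => by simp [boundedRank, X.rank_le_width]

lemma isProximalNormal_truncation {ι : Type*} [Fintype ι] [DecidableEq ι]
    (v : OrthonormalBasis ι 𝕜 (EuclideanSpace 𝕜 (Fin n₂))) {s : Finset ι}
    {Z : Matrix (Fin n₁) (Fin n₂) 𝕜}
    (hZ : Pairwise fun i j => inner 𝕜 (toEuclideanLin Z (v i)) (toEuclideanLin Z (v j)) = 0)
    {σ τ : ℝ} (hσ : 0 < σ) (hτ : 0 ≤ τ) (hlarge : ∀ i ∈ s, σ ≤ ‖toEuclideanLin Z (v i)‖)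
    (hsmall : ∀ i ∉ s, ‖toEuclideanLin Z (v i)‖ ≤ τ) :
    IsProximalNormal (boundedRank 𝕜 n₁ n₂ s.card) (τ / σ)
      (toEuclideanLin.symm (truncation v s (toEuclideanLin Z)))
      (Z - toEuclideanLin.symm (truncation v s (toEuclideanLin Z))) := by
  set X := toEuclideanLin.symm (truncation v s (toEuclideanLin Z)) with hX
  have hXlin : toEuclideanLin X = truncation v s (toEuclideanLin Z) := by
    rw [hX, LinearEquiv.apply_symm_apply]
  have hmem : X ∈ boundedRank 𝕜 n₁ n₂ s.card := by
    rw [boundedRank, Set.mem_ofPred_eq, rank_eq_finrank_range_toEuclideanLin, hXlin]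
    exact finrank_range_truncation_le _ _ _
  have hdilated {c : ℝ} (hc : 0 ≤ c) (hcτ : c * τ ≤ σ) :
      IsProximalNormal (boundedRank 𝕜 n₁ n₂ s.card) 1 X (c • (Z - X)) := by
    refine .of_norm_sq_le hmem fun Y hY => ?_
    rw [boundedRank, Set.mem_ofPred_eq, rank_eq_finrank_range_toEuclideanLin] at hY
    simp only [frobenius_norm_sq_eq_sum v, RCLike.real_smul_eq_coe_smul (K := 𝕜), map_sub,
      map_smul, hXlin]
    exact sum_norm_sq_smul_sub_truncation_le v hZ hσ.le hc hlarge
      (fun i hi => (mul_le_mul_of_nonneg_left (hsmall i hi) hc).trans hcτ) hY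
  rcases hτ.eq_or_lt with rfl | hτ
  · have hZX : ‖Z - X‖ ^ 2 = 0 := by
      rw [frobenius_norm_sq_eq_sum v]
      refine Finset.sum_eq_zero fun i _ => ?_
      rw [map_sub, LinearMap.sub_apply, hXlin, truncation_apply_basis]
      split_ifs with hi
      · simp
      · simpa using hsmall i hi
    refine ⟨hmem, fun Y _ => ?_⟩
    simp [norm_eq_zero.1 (pow_eq_zero_iff two_ne_zero |>.1 hZX)]
  · simpa using (hdilated (div_pos hσ hτ).le (div_mul_cancel₀ σ hτ.ne').le).of_smul (div_pos hσ hτ)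

lemma singularValue_nonneg (j : ℕ) (Z : Matrix (Fin n₁) (Fin n₂) 𝕜) : 0 ≤ singularValue j Z :=
  LinearMap.singularValues_nonneg _ _

lemma singularValue_succ_le (j : ℕ) (Z : Matrix (Fin n₁) (Fin n₂) 𝕜) :
    singularValue (j + 1) Z ≤ singularValue j Z :=
  LinearMap.singularValues_antitone _ (by lia)

lemma exists_isProximalNormal_boundedRank (Z : Matrix (Fin n₁) (Fin n₂) 𝕜)
    (hσ : 0 < singularValue K Z) :
    ∃ X, IsProximalNormal (boundedRank 𝕜 n₁ n₂ K) (singularValue (K + 1) Z / singularValue K Z) X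
      (Z - X) := by
  obtain ⟨v, horth, hnorm⟩ :=
    exists_orthonormalBasis_singularValues (finrank_euclideanSpace_fin (𝕜 := 𝕜)) (toEuclideanLin Z)
  let s : Finset (Fin n₂) := {i | i.val < K}
  have hcard : s.card = min K n₂ := Fin.card_filter_val_lt.trans (min_comm _ _)
  rw [← boundedRank_min_width, ← hcard]
  refine ⟨_, isProximalNormal_truncation (s := s) (σ := singularValue K Z)
    (τ := singularValue (K + 1) Z) v horth hσ (singularValue_nonneg (K + 1) Z) ?_ ?_⟩
  all_goals
    intro i hi
    rw [hnorm]
    refine LinearMap.singularValues_antitone _ ?_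
    simp only [s, Finset.mem_filter_univ] at hi
    lia

lemma IsProximalNormal.singularValue_div {X Z : Matrix (Fin n₁) (Fin n₂) 𝕜}
    (h : IsProximalNormal (boundedRank 𝕜 n₁ n₂ K) 1 X (Z - X)) (hσ : 0 < singularValue K Z) :
    IsProximalNormal (boundedRank 𝕜 n₁ n₂ K) (singularValue (K + 1) Z / singularValue K Z) X
      (Z - X) := by
  obtain ⟨W, hW⟩ := exists_isProximalNormal_boundedRank Z hσ
  rcases (singularValue_succ_le K Z).eq_or_lt with heq | hlt
  · rwa [heq, div_self hσ.ne']
  · have hgap : 1 + singularValue (K + 1) Z / singularValue K Z < 2 := by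
      linarith [(div_lt_one hσ).2 hlt]
    have hXW : X = W := h.eq_of_add_eq_add hW hgap (by rw [add_sub_cancel, add_sub_cancel])
    rwa [hXW]

end Matrix

section Uniqueness

variable {𝕜 : Type*} [RCLike 𝕜] {n₁ n₂ : ℕ} {F : Type*} [NormedAddCommGroup F]
  [InnerProductSpace ℝ F]

lemma one_sub_lrip_mul_norm_sq_le (A : Matrix (Fin n₁) (Fin n₂) 𝕜 →ₗ[ℝ] F) {r : ℕ}
    {X : Matrix (Fin n₁) (Fin n₂) 𝕜} (hX : X.rank ≤ r) :
    (1 - lrip A r) * ‖X‖ ^ 2 ≤ ‖A X‖ ^ 2 := by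
  rcases eq_or_ne X 0 with rfl | hX0
  · simp
  have hpos : 0 < ‖X‖ ^ 2 := pow_pos (norm_pos_iff.2 hX0) 2
  rw [← le_div_iff₀ hpos, lrip, sub_sub_cancel]
  refine csInf_le ⟨0, ?_⟩ ⟨X, hX0, hX, rfl⟩
  rintro _ ⟨Y, -, -, rfl⟩
  positivity

lemma rankIndicator_nonneg (K : ℕ) (X : Matrix (Fin n₁) (Fin n₂) 𝕜) : 0 ≤ rankIndicator K X := by
  rw [rankIndicator]
  split_ifs <;> simp

variable [FiniteDimensional ℝ F] {A : Matrix (Fin n₁) (Fin n₂) 𝕜 →ₗ[ℝ] F} {b : F}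

lemma dualPoint_sub_self (X : Matrix (Fin n₁) (Fin n₂) 𝕜) :
    dualPoint A b X - X = LinearMap.adjoint A (b - A X) := by
  rw [dualPoint, map_sub]
  abel

lemma IsStationaryPoint.isProximalNormal_dualPoint {K : ℕ} {X : Matrix (Fin n₁) (Fin n₂) 𝕜}
    (hst : IsStationaryPoint (regularizedFunctional A b K) X) (hX : X.rank ≤ K) :
    IsProximalNormal (boundedRank 𝕜 n₁ n₂ K) 1 X (dualPoint A b X - X) := by
  refine ⟨hX, fun Y hY => ?_⟩
  have hfirst := IsStationaryPoint.nonneg_of_hasLineDerivAt zero_le_two (rankIndicator_nonneg K)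
    hst (if_pos hX) (if_pos hY) (hasLineDerivAt_norm_sub_sq A b X (Y - X))
  rw [dualPoint_sub_self, LinearMap.adjoint_inner_left, ← neg_sub (A X) b, inner_neg_left]
  linarith

lemma inner_dualPoint_sub_self_sub (X Y : Matrix (Fin n₁) (Fin n₂) 𝕜) :
    inner ℝ (dualPoint A b X - X - (dualPoint A b Y - Y)) (Y - X) = ‖A (Y - X)‖ ^ 2 := by
  rw [dualPoint_sub_self, dualPoint_sub_self, ← map_sub, sub_sub_sub_cancel_left, ← map_sub A,
    LinearMap.adjoint_inner_left, real_inner_self_eq_norm_sq]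

end Uniqueness

theorem theorem6p1 {𝕜 : Type*} [RCLike 𝕜] {n₁ n₂ : ℕ}
    {F : Type*} [NormedAddCommGroup F] [InnerProductSpace ℝ F] [FiniteDimensional ℝ F]
    (A : Matrix (Fin n₁) (Fin n₂) 𝕜 →ₗ[ℝ] F) (b : F) (K : ℕ) (hK : 1 ≤ K)
    (X' : Matrix (Fin n₁) (Fin n₂) 𝕜)
    (hX' : IsStationaryPoint (regularizedFunctional A b K) X')
    (hrank : X'.rank ≤ K)
    (hσ : singularValue (K + 1) (dualPoint A b X')
      < (1 - 2 * lrip A (2 * K)) * singularValue K (dualPoint A b X')) :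
    ∀ X'' : Matrix (Fin n₁) (Fin n₂) 𝕜,
      IsStationaryPoint (regularizedFunctional A b K) X'' → X''.rank ≤ K → X'' = X' := by
  intro X'' hX'' hrank''
  have hpos : 0 < singularValue K (dualPoint A b X') :=
    (singularValue_nonneg K _).lt_of_ne fun h =>
      (singularValue_nonneg (K + 1) _).not_gt (by simpa [← h] using hσ)
  have hratio := (div_lt_iff₀ hpos).2 hσ
  have hnormal' := (hX'.isProximalNormal_dualPoint hrank).singularValue_div hpos
  have hnormal'' := hX''.isProximalNormal_dualPoint hrank''
  have hupper := hnormal'.two_mul_inner_sub_le hnormal''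
  rw [inner_dualPoint_sub_self_sub] at hupper
  have hlower := one_sub_lrip_mul_norm_sq_le A (r := 2 * K) (X := X'' - X')
    ((rank_sub_le X'' X').trans (by lia))
  by_contra hne
  have hdist : 0 < ‖X'' - X'‖ ^ 2 := pow_pos (norm_pos_iff.2 (sub_ne_zero.2 hne)) 2
  linarith [mul_lt_mul_of_pos_right hratio hdist]
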